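/- Let $K$ be a field. A simplicial complex $\Delta$ on a finite vertex set $V(\Delta)$ is a collection of subsets of $V(\Delta)$, called faces, that contains $\emptyset$ and is closed under taking subsets. Its Stanley--Reisner ring $K[\Delta]$ is the quotient of the polynomial ring $K[V(\Delta)]$, whose variables are the vertices, by the ideal generated by the products $\prod_{v\in F} v$ over all $F\subseteq V(\Delta)$ that are not faces, and $\mathrm{pd}^K(\Delta)$ denotes the projective dimension of $K[\Delta]$ as a $K[V(\Delta)]$-module. The join $\Delta_1*\Delta_2$ is the simplicial complex with vertex set $V(\Delta_1)\cup V(\Delta_2)$ and faces $F_1\cup F_2$ with $F_1\in\Delta_1$, $F_2\in\Delta_2$. For a finite simple graph $G$ with vertex set $V(G)$, let $\Delta(G)$ be the simplicial complex on $V(G)$ whose faces are the sets of vertices no two of which are joined by an edge, and put $\mathrm{pd}^K(G)=\mathrm{pd}^K(\Delta(G))$. **Corollary.** Let $\Delta_1,\Delta_2$ be simplicial complexes with $V(\Delta_1)\cap V(\Delta_2)=\emptyset$. Then $$\mathrm{pd}^K(\Delta_1*\Delta_2)=\mathrm{pd}^K(\Delta_1)+\mathrm{pd}^K(\Delta_2).$$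 In particular, if $G_1$ and $G_2$ are finite simple graphs with disjoint vertex sets and $G=G_1\cup G_2$, then $$\mathrm{pd}^K(G)=\mathrm{pd}^K(G_1)+\mathrm{pd}^K(G_2).$$ -/

import Mathlib

namespace StanleyReisner

universe u v

/-- An (abstract) simplicial complex together with its vertex set, the vertices being elements of
an ambient type `α`.  As in Mathlib, only the nonempty faces are listed in `faces`; the empty set is
always a face, see `IsFace`.  A vertex `v` is not required to be a face `{v}`. -/
structure SimplicialComplex (α : Type u) extends PreAbstractSimplicialComplex α where
  /-- the vertex set `V(Δ)` -/
  verts : Set α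
  subset_verts : ∀ s ∈ faces, (s : Set α) ⊆ verts

variable {α : Type u}

namespace SimplicialComplex

/-- `s` is a face of `Δ`, the empty face included. -/
def IsFace (Δ : SimplicialComplex α) (s : Finset α) : Prop :=
  s = ∅ ∨ s ∈ Δ.faces

theorem IsFace.mono {Δ : SimplicialComplex α} {s t : Finset α} (hs : Δ.IsFace s) (h : t ⊆ s) :
    Δ.IsFace t := by
  rcases t.eq_empty_or_nonempty with rfl | ht
  · exact Or.inl rfl
  · rcases hs with rfl | hs
    · exact Or.inl (Finset.subset_empty.mp h)
    · exact Or.inr ((Δ.isRelLowerSet_faces hs).2 h ht)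

theorem IsFace.subset_verts {Δ : SimplicialComplex α} {s : Finset α} (hs : Δ.IsFace s) :
    (s : Set α) ⊆ Δ.verts := by
  rcases hs with rfl | hs
  · simp
  · exact Δ.subset_verts s hs

/-- The join `Δ₁ * Δ₂`: its vertex set is `V(Δ₁) ∪ V(Δ₂)` and its faces are the sets `F₁ ∪ F₂` with
`F₁` a face of `Δ₁` and `F₂` a face of `Δ₂` (either may be empty). -/
def join [DecidableEq α] (Δ₁ Δ₂ : SimplicialComplex α) : SimplicialComplex α where
  faces := {s | s.Nonempty ∧ ∃ F₁ F₂ : Finset α, Δ₁.IsFace F₁ ∧ Δ₂.IsFace F₂ ∧ s = F₁ ∪ F₂}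
  isRelLowerSet_faces := by
    rintro s ⟨hs, F₁, F₂, h₁, h₂, rfl⟩
    refine ⟨hs, fun t ht htn => ⟨htn, t ∩ F₁, t ∩ F₂, h₁.mono Finset.inter_subset_right,
      h₂.mono Finset.inter_subset_right, ?_⟩⟩
    rw [← Finset.inter_union_distrib_left]
    exact (Finset.inter_eq_left.mpr ht).symm
  verts := Δ₁.verts ∪ Δ₂.verts
  subset_verts := by
    rintro s ⟨-, F₁, F₂, h₁, h₂, rfl⟩
    rw [Finset.coe_union]
    exact Set.union_subset_union h₁.subset_verts h₂.subset_verts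

variable (K : Type v) [Field K]

/-- The Stanley-Reisner ideal of `Δ` in the polynomial ring `K[V(Δ)]`, generated by the products
of the vertices in a non-face. -/
noncomputable def ideal (Δ : SimplicialComplex α) : Ideal (MvPolynomial Δ.verts K) :=
  Ideal.span {p | ∃ F : Finset Δ.verts,
    ¬ Δ.IsFace (F.map (Function.Embedding.subtype (· ∈ Δ.verts))) ∧
      p = ∏ w ∈ F, MvPolynomial.X w}

/-- The Stanley-Reisner ring `K[Δ]`. -/
abbrev StanleyReisnerRing (Δ : SimplicialComplex α) : Type (max u v) :=
  MvPolynomial Δ.verts K ⧸ Δ.ideal K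

/-- `pd^K(Δ)`: the projective dimension of `K[Δ]` as a module over `K[V(Δ)]`. -/
noncomputable def pd (Δ : SimplicialComplex α) : WithBot ℕ∞ :=
  CategoryTheory.projectiveDimension
    (ModuleCat.of (MvPolynomial Δ.verts K) (Δ.StanleyReisnerRing K))

end SimplicialComplex

/-- A simple graph with vertex set contained in `α` (an arbitrary vertex set and an arbitrary
symmetric irreflexive adjacency relation on it): a subgraph of the complete graph on `α`.
The union of two graphs is then `G₁ ⊔ G₂`. -/
abbrev Graph (α : Type u) : Type u := (⊤ : SimpleGraph α).Subgraph

namespace Graph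

/-- `Δ(G)`: the simplicial complex on `V(G)` whose faces are the sets of vertices of `G`, no two
of which are joined by an edge. -/
def independenceComplex (G : Graph α) : SimplicialComplex α where
  faces := {s | s.Nonempty ∧ (s : Set α) ⊆ G.verts ∧ ∀ v ∈ s, ∀ w ∈ s, ¬ G.Adj v w}
  isRelLowerSet_faces := by
    rintro s ⟨hs, hsub, hadj⟩
    exact ⟨hs, fun t ht htn => ⟨htn, (Finset.coe_subset.mpr ht).trans hsub,
      fun v hv w hw => hadj v (ht hv) w (ht hw)⟩⟩
  verts := G.verts
  subset_verts := fun _ hs => hs.2.1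

/-- `pd^K(G)`: the projective dimension of `K[Δ(G)]` as a module over `K[V(G)]`. -/
noncomputable def pd (K : Type v) [Field K] (G : Graph α) : WithBot ℕ∞ :=
  (independenceComplex G).pd K

end Graph

end StanleyReisner

/-! In disjoint sets of variables, the nonfaces of a join are the sets containing a nonface of one
of the two complexes, so the ideal of the join is the sum of the two extended ideals (`ideal_join`).
With `A = K[V(Δ₁)]` and `B = K[V(Δ₂)]`, the ring of the join is therefore `A/I ⊗ B/J` over `A ⊗ B`.
The graph statement follows because, when the vertex sets are disjoint, the independence complex of
the union is the join.

What remains is `pd (M ⊗ N) = pd M + pd N` over `A ⊗ B`, for finite modules `M`, `N` over Noetherian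
`K`-algebras (`projectiveDimension_eq_add`). No grading or minimal resolution is used. The upper
bound is an induction along syzygies, exactness being free over a field. For the lower bound,
syzygies reduce positive dimensions to the case where both are 1; when one dimension is 0, the other
factor is a retract of `M ⊗ N` after restriction of scalars.

In the core case (`not_projDimLT_two`), write `M = F/S` and `N = G/T` with `F`, `G` free. The kernel
`Z` of `F ⊗ G → M ⊗ N` sits in `0 → S ⊗ T → (S ⊗ G) × (F ⊗ T) → Z → 0`. If `pd (M ⊗ N) < 2`, then
`Z` is projective and the first map has a retraction. But `S → F` and `T → G` have none, and pairing
with finitely many `K`-linear functionals that detect this gives a contradiction (`no_retraction`).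
-/

open scoped TensorProduct

/-! ### External tensor products: functoriality, exactness, projectivity -/

/-- The tensor product over `K` of an `A`-module and a `B`-module, with its structure of a module
over `A ⊗[K] B`. A synonym, so that this structure does not clash with the one of a ring over
itself. -/
def ExternalTensor (K M N : Type*) [Field K] [AddCommGroup M] [AddCommGroup N] [Module K M]
    [Module K N] : Type _ :=
  M ⊗[K] N

namespace ExternalTensor

section Basic

variable {K A B M M' M'' N N' N'' : Type*} [Field K] [CommRing A] [CommRing B] [Algebra K A]
  [Algebra K B]
  [AddCommGroup M] [Module K M] [Module A M] [IsScalarTower K A M]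
  [AddCommGroup M'] [Module K M'] [Module A M'] [IsScalarTower K A M']
  [AddCommGroup M''] [Module K M''] [Module A M''] [IsScalarTower K A M'']
  [AddCommGroup N] [Module K N] [Module B N] [IsScalarTower K B N]
  [AddCommGroup N'] [Module K N'] [Module B N'] [IsScalarTower K B N']
  [AddCommGroup N''] [Module K N''] [Module B N''] [IsScalarTower K B N'']

noncomputable instance : AddCommGroup (ExternalTensor K M N) :=
  inferInstanceAs (AddCommGroup (M ⊗[K] N))

noncomputable instance : Module K (ExternalTensor K M N) :=
  inferInstanceAs (Module K (M ⊗[K] N))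

/-- The action of `A ⊗[K] B` on `M ⊗[K] N`. -/
noncomputable def action (K A B M N : Type*) [Field K] [CommRing A] [CommRing B] [Algebra K A]
    [Algebra K B] [AddCommGroup M] [Module K M] [Module A M] [IsScalarTower K A M]
    [AddCommGroup N] [Module K N] [Module B N] [IsScalarTower K B N] :
    A ⊗[K] B →ₐ[K] Module.End K (M ⊗[K] N) :=
  (Module.endTensorEndAlgHom (R := K) (S := K) (A := K) (M := M) (N := N)).comp
    (Algebra.TensorProduct.map (Algebra.lsmul K K M) (Algebra.lsmul K K N))

noncomputable instance : Module (A ⊗[K] B) (ExternalTensor K M N) :=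
  Module.compHom (M ⊗[K] N) (action K A B M N).toRingHom

/-- The elementary tensor `m ⊗ n`. -/
def tmul (K : Type*) {M N : Type*} [Field K] [AddCommGroup M] [AddCommGroup N] [Module K M]
    [Module K N] (m : M) (n : N) : ExternalTensor K M N :=
  m ⊗ₜ[K] n

theorem smul_tmul (a : A) (b : B) (m : M) (n : N) :
    (a ⊗ₜ[K] b) • tmul K m n = tmul K (a • m) (b • n) :=
  rfl

@[elab_as_elim]
theorem induction_on {p : ExternalTensor K M N → Prop} (x : ExternalTensor K M N) (zero : p 0)
    (tmul : ∀ m n, p (tmul K m n)) (add : ∀ x y, p x → p y → p (x + y)) : p x :=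
  TensorProduct.induction_on (motive := p) x zero tmul add

variable (A B) in
/-- An additive map out of a tensor product is linear over `A ⊗[K] B` if it is so on elementary
tensors. -/
noncomputable def linearMapOfTmul {X : Type*} [AddCommGroup X] [Module (A ⊗[K] B) X]
    (f : ExternalTensor K M N →+ X)
    (h : ∀ (a : A) (b : B) (m : M) (n : N),
      f (tmul K (a • m) (b • n)) = (a ⊗ₜ[K] b) • f (tmul K m n)) :
    ExternalTensor K M N →ₗ[A ⊗[K] B] X where
  toFun := f
  map_add' := f.map_add
  map_smul' r x := by
    induction r using TensorProduct.induction_on with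
    | zero => simp
    | add r s hr hs =>
      simp only [RingHom.id_apply] at hr hs ⊢
      rw [add_smul, map_add, hr, hs, add_smul]
    | tmul a b =>
      induction x using induction_on with
      | zero => simp
      | add x y hx hy =>
        simp only [RingHom.id_apply] at hx hy ⊢
        rw [smul_add, map_add, hx, hy, map_add, smul_add]
      | tmul m n => rw [smul_tmul]; exact h a b m n

variable (K) in
/-- The tensor product of an `A`-linear and a `B`-linear map. -/
noncomputable def map (f : M →ₗ[A] M') (g : N →ₗ[B] N') :
    ExternalTensor K M N →ₗ[A ⊗[K] B] ExternalTensor K M' N' :=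
  linearMapOfTmul A B
    (TensorProduct.map (f.restrictScalars K) (g.restrictScalars K)).toAddMonoidHom
    (fun a b m n => by
      change tmul K (f (a • m)) (g (b • n)) = (a ⊗ₜ[K] b) • tmul K (f m) (g n)
      rw [smul_tmul, map_smul, map_smul])

theorem map_tmul (f : M →ₗ[A] M') (g : N →ₗ[B] N') (m : M) (n : N) :
    map K f g (tmul K m n) = tmul K (f m) (g n) :=
  rfl

theorem linearMap_ext {X : Type*} [AddCommGroup X] [Module (A ⊗[K] B) X]
    {f g : ExternalTensor K M N →ₗ[A ⊗[K] B] X}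
    (h : ∀ m n, f (tmul K m n) = g (tmul K m n)) : f = g := by
  ext x
  induction x using induction_on with
  | zero => simp
  | tmul m n => exact h m n
  | add x y hx hy => rw [map_add, map_add, hx, hy]

/-- Every module over the field `K` is flat, so tensoring with a fixed factor preserves injections
and exact sequences; the next few lemmas record this for `map`. -/
theorem map_left_injective {f : M →ₗ[A] M'} (hf : Function.Injective f) :
    Function.Injective (map K f (LinearMap.id : N →ₗ[B] N)) :=
  Module.Flat.rTensor_preserves_injective_linearMap (R := K) (M := N) (f.restrictScalars K) hf

theorem map_right_injective {g : N →ₗ[B] N'} (hg : Function.Injective g) :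
    Function.Injective (map K (LinearMap.id : M →ₗ[A] M) g) :=
  Module.Flat.lTensor_preserves_injective_linearMap (R := K) (M := M) (g.restrictScalars K) hg

theorem map_left_surjective {f : M →ₗ[A] M'} (hf : Function.Surjective f) :
    Function.Surjective (map K f (LinearMap.id : N →ₗ[B] N)) :=
  LinearMap.rTensor_surjective (R := K) N (g := f.restrictScalars K) hf

theorem map_left_exact {f : M →ₗ[A] M'} {g : M' →ₗ[A] M''} (h : Function.Exact f g) :
    Function.Exact (map K f (LinearMap.id : N →ₗ[B] N))
      (map K g (LinearMap.id : N →ₗ[B] N)) :=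
  Module.Flat.rTensor_exact (R := K) N (f := f.restrictScalars K) (g := g.restrictScalars K) h

theorem map_right_exact {f : N →ₗ[B] N'} {g : N' →ₗ[B] N''} (h : Function.Exact f g) :
    Function.Exact (map K (LinearMap.id : M →ₗ[A] M) f)
      (map K (LinearMap.id : M →ₗ[A] M) g) :=
  Module.Flat.lTensor_exact (R := K) M (f := f.restrictScalars K) (g := g.restrictScalars K) h

/-- The kernel of a tensor product of two surjections is the sum of the images of the two kernels
tensored with the other factor. This supplies surjectivity onto `Z` in `not_projDimLT_two`. -/
theorem exists_of_map_eq_zero {f : M →ₗ[A] M'} {g : M' →ₗ[A] M''} {f' : N →ₗ[B] N'}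
    {g' : N' →ₗ[B] N''} (h : Function.Exact f g) (hg : Function.Surjective g)
    (h' : Function.Exact f' g') (hg' : Function.Surjective g') {z : ExternalTensor K M' N'}
    (hz : map K g g' z = 0) :
    ∃ (x : ExternalTensor K M N') (y : ExternalTensor K M' N),
      map K f (LinearMap.id : N' →ₗ[B] N') x + map K (LinearMap.id : M' →ₗ[A] M') f' y = z := by
  have hz' : (z : M' ⊗[K] N') ∈
      LinearMap.ker (TensorProduct.map (g.restrictScalars K) (g'.restrictScalars K)) := hz
  rw [TensorProduct.map_ker (f := f.restrictScalars K) (f' := f'.restrictScalars K)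
    (g := g.restrictScalars K) (g' := g'.restrictScalars K) h hg h' hg'] at hz'
  obtain ⟨_, ⟨y, rfl⟩, _, ⟨x, rfl⟩, rfl⟩ :=
    (Submodule.mem_sup (M := M' ⊗[K] N')).mp hz'
  exact ⟨x, y, add_comm (G := M' ⊗[K] N') _ _⟩

/-- The external tensor product of free modules is free. -/
noncomputable def finsuppEquiv (K A B : Type*) [Field K] [CommRing A] [CommRing B] [Algebra K A]
    [Algebra K B] (ι κ : Type*) :
    ExternalTensor K (ι →₀ A) (κ →₀ B) ≃ₗ[A ⊗[K] B] (ι × κ →₀ A ⊗[K] B) :=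
  LinearEquiv.ofBijective
    (linearMapOfTmul A B (finsuppTensorFinsupp K K A B ι κ).toAddEquiv.toAddMonoidHom
      (fun a b m n => by
        change finsuppTensorFinsupp K K A B ι κ ((a • m) ⊗ₜ (b • n)) =
          (a ⊗ₜ[K] b) • finsuppTensorFinsupp K K A B ι κ (m ⊗ₜ n)
        ext ⟨i, k⟩
        simp))
    (finsuppTensorFinsupp K K A B ι κ).bijective

theorem map_comp (f : M →ₗ[A] M') (f' : M' →ₗ[A] M'') (g : N →ₗ[B] N') (g' : N' →ₗ[B] N'') :
    (map K f' g').comp (map K f g) = map K (f'.comp f) (g'.comp g) :=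
  linearMap_ext fun _ _ => rfl

theorem map_left_map_right (f : M →ₗ[A] M') (g : N →ₗ[B] N') (x : ExternalTensor K M N) :
    map K f (LinearMap.id : N' →ₗ[B] N') (map K (LinearMap.id : M →ₗ[A] M) g x) =
      map K (LinearMap.id : M' →ₗ[A] M') g (map K f (LinearMap.id : N →ₗ[B] N) x) := by
  induction x using induction_on with
  | zero => simp
  | tmul m n => rfl
  | add x y hx hy => simp only [map_add, hx, hy]

theorem map_id : map K (LinearMap.id : M →ₗ[A] M) (LinearMap.id : N →ₗ[B] N) = LinearMap.id :=
  linearMap_ext fun _ _ => rfl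

/-- Projectives are retracts of free modules, and the external tensor product of free modules is
free. -/
theorem projective (hM : Module.Projective A M) (hN : Module.Projective B N) :
    Module.Projective (A ⊗[K] B) (ExternalTensor K M N) := by
  obtain ⟨s, hs⟩ := Module.projective_def'.mp hM
  obtain ⟨t, ht⟩ := Module.projective_def'.mp hN
  have : Module.Projective (A ⊗[K] B) (ExternalTensor K (M →₀ A) (N →₀ B)) :=
    Module.Projective.of_equiv (finsuppEquiv K A B M N).symm
  refine Module.Projective.of_split (map K s t)
    (map K (Finsupp.linearCombination A id) (Finsupp.linearCombination B id)) ?_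
  rw [map_comp, hs, ht, map_id]

variable (K A B M N) in
/-- Commutativity of the external tensor product, as an additive equivalence. -/
noncomputable def commEquiv : ExternalTensor K M N ≃+ ExternalTensor K N M :=
  (TensorProduct.comm K M N).toAddEquiv

theorem commEquiv_smul (r : A ⊗[K] B) (x : ExternalTensor K M N) :
    commEquiv K M N (r • x) = Algebra.TensorProduct.comm K A B r • commEquiv K M N x := by
  induction r using TensorProduct.induction_on with
  | zero => simp
  | add r s hr hs => rw [add_smul, map_add, hr, hs, map_add, add_smul]
  | tmul a b =>
    induction x using induction_on with
    | zero => simp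
    | add x y hx hy => rw [smul_add, map_add, hx, hy, map_add, smul_add]
    | tmul m n => rfl

/-! ### Contractions and the obstruction to a retraction -/

/-- Contraction of the left factor by a functional. -/
noncomputable def contractLeft (φ : M →ₗ[K] K) : ExternalTensor K M N →ₗ[K] N :=
  (TensorProduct.lid K N).toLinearMap ∘ₗ LinearMap.rTensor N φ

/-- Contraction of the right factor by a functional. -/
noncomputable def contractRight (ψ : N →ₗ[K] K) : ExternalTensor K M N →ₗ[K] M :=
  (TensorProduct.rid K M).toLinearMap ∘ₗ LinearMap.lTensor M ψ

theorem contractLeft_tmul (φ : M →ₗ[K] K) (m : M) (n : N) :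
    contractLeft φ (tmul K m n) = φ m • n :=
  rfl

theorem contractRight_tmul (ψ : N →ₗ[K] K) (m : M) (n : N) :
    contractRight ψ (tmul K m n) = ψ n • m :=
  rfl

theorem contractLeft_smul (φ : M →ₗ[K] K) (b : B) (x : ExternalTensor K M N) :
    contractLeft φ (((1 : A) ⊗ₜ[K] b) • x) = b • contractLeft φ x := by
  induction x using induction_on with
  | zero => simp
  | add x y hx hy => rw [smul_add, map_add, hx, hy, map_add, smul_add]
  | tmul m n => rw [smul_tmul, contractLeft_tmul, contractLeft_tmul, one_smul, smul_comm]

theorem contractRight_smul (ψ : N →ₗ[K] K) (a : A) (x : ExternalTensor K M N) :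
    contractRight ψ ((a ⊗ₜ[K] (1 : B)) • x) = a • contractRight ψ x := by
  induction x using induction_on with
  | zero => simp
  | add x y hx hy => rw [smul_add, map_add, hx, hy, map_add, smul_add]
  | tmul m n => rw [smul_tmul, contractRight_tmul, contractRight_tmul, one_smul, smul_comm]

/-- Both sides are `φ ⊗ ψ` applied to `x`. -/
theorem contract_comm (φ : M →ₗ[K] K) (ψ : N →ₗ[K] K) (x : ExternalTensor K M N) :
    ψ (contractLeft φ x) = φ (contractRight ψ x) := by
  induction x using induction_on with
  | zero => simp
  | add x y hx hy => rw [map_add, map_add, hx, hy, map_add, map_add]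
  | tmul m n => simp [contractLeft_tmul, contractRight_tmul, mul_comm]

theorem tmul_add (m : M) (n n' : N) : tmul K m (n + n') = tmul K m n + tmul K m n' :=
  TensorProduct.tmul_add m n n'

theorem add_tmul (m m' : M) (n : N) : tmul K (m + m') n = tmul K m n + tmul K m' n :=
  TensorProduct.add_tmul m m' n

variable (K) in
/-- A linear map without retraction on a finite module is detected by finitely many functionals. -/
theorem exists_functionals [Module.Finite A M] {P : Type*} [AddCommGroup P] [Module A P]
    (i : M →ₗ[A] P)
    (hi : ¬ ∃ r : P →ₗ[A] M, r.comp i = LinearMap.id) :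
    ∃ (k : ℕ) (p : Fin k → M) (φ : Fin k → M →ₗ[K] K),
      ∑ s, φ s (p s) ≠ 0 ∧ ∀ u : P →ₗ[A] M, ∑ s, φ s (u (i (p s))) = 0 := by
  obtain ⟨k, p, hp⟩ := Module.Finite.exists_fin (R := A) (M := M)
  -- The tuples obtained from the generators by endomorphisms that factor through `i`. If the tuple
  -- of generators were among them, the corresponding `u` would be a retraction; hence a functional
  -- on the `K`-space of tuples separates it from `I`.
  let I : Submodule K (Fin k → M) :=
    { carrier := {w | ∃ u : P →ₗ[A] M, ∀ s, w s = u (i (p s))}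
      zero_mem' := ⟨0, fun _ => rfl⟩
      add_mem' := by
        rintro _ _ ⟨u, hu⟩ ⟨v, hv⟩
        exact ⟨u + v, fun s => by simp [hu, hv]⟩
      smul_mem' := by
        rintro c _ ⟨u, hu⟩
        exact ⟨c • u, fun s => by simp [hu]⟩ }
  have hpI : p ∉ I := by
    rintro ⟨u, hu⟩
    refine hi ⟨u, LinearMap.ext_on_range hp fun s => ?_⟩
    simp [← hu]
  obtain ⟨φ, hφ, hI⟩ := Submodule.exists_le_ker_of_notMem hpI
  have key (w : Fin k → M) : ∑ s, (φ ∘ₗ LinearMap.single K (fun _ => M) s) (w s) = φ w := by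
    simp only [LinearMap.comp_apply, ← map_sum]
    congr 1
    exact LinearMap.sum_single_apply _ w
  refine ⟨k, p, fun s => φ ∘ₗ LinearMap.single K (fun _ => M) s, ?_, fun u => ?_⟩
  · rw [key p]; exact hφ
  · rw [key fun s => u (i (p s))]
    exact hI ⟨u, fun _ => rfl⟩

/-- If neither `i` nor `j` has a retraction, then `(1 ⊗ j, i ⊗ 1)` has none either. -/
theorem no_retraction [Module.Finite A M] [Module.Finite B N]
    (i : M →ₗ[A] M') (j : N →ₗ[B] N')
    (hi : ¬ ∃ r : M' →ₗ[A] M, r.comp i = LinearMap.id)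
    (hj : ¬ ∃ r : N' →ₗ[B] N, r.comp j = LinearMap.id)
    (f : ExternalTensor K M N' →ₗ[A ⊗[K] B] ExternalTensor K M N)
    (g : ExternalTensor K M' N →ₗ[A ⊗[K] B] ExternalTensor K M N) :
    f.comp (map K LinearMap.id j) + g.comp (map K i LinearMap.id) ≠ LinearMap.id := by
  obtain ⟨k, p, φ, hφ, hi⟩ := exists_functionals K i hi
  obtain ⟨l, q, ψ, hψ, hj⟩ := exists_functionals K j hj
  intro h
  -- For fixed `s`, contracting by `φ s` turns `f (p s ⊗ ·)` into a `B`-linear map `N' → N`, to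
  -- which the vanishing property of `ψ` applies. The next claim is symmetric.
  have h0 (s : Fin k) : ∑ t, ψ t (contractLeft (φ s) (f (tmul K (p s) (j (q t))))) = 0 :=
    hj { toFun := fun n => contractLeft (φ s) (f (tmul K (p s) n))
         map_add' := fun n n' => by rw [tmul_add, map_add, map_add]
         map_smul' := fun b n => by
          rw [RingHom.id_apply, ← contractLeft_smul (A := A), ← map_smul, smul_tmul, one_smul] }
  have h1 (t : Fin l) : ∑ s, φ s (contractRight (ψ t) (g (tmul K (i (p s)) (q t)))) = 0 :=
    hi { toFun := fun m => contractRight (ψ t) (g (tmul K m (q t)))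
         map_add' := fun n n' => by rw [add_tmul, map_add, map_add]
         map_smul' := fun b n => by
          rw [RingHom.id_apply, ← contractRight_smul (B := B), ← map_smul, smul_tmul, one_smul] }
  -- Apply `φ s ⊗ ψ t` to the supposed identity evaluated at `p s ⊗ q t`. Summed over `s` and `t`,
  -- the left side vanishes while the right side is a product of two nonzero scalars.
  have h2 (s : Fin k) (t : Fin l) :
      ψ t (contractLeft (φ s) (f (tmul K (p s) (j (q t))))) +
        φ s (contractRight (ψ t) (g (tmul K (i (p s)) (q t)))) = φ s (p s) * ψ t (q t) := by
    have := congrArg (fun F => ψ t (contractLeft (φ s) (F (tmul K (p s) (q t))))) h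
    simpa [map_tmul, contractLeft_tmul, contract_comm] using this
  apply mul_ne_zero hφ hψ
  rw [Finset.sum_mul_sum]
  simp only [← h2, Finset.sum_add_distrib, h0]
  rw [Finset.sum_comm]
  simp [h1]

end Basic
end ExternalTensor

/-! ### Bounds on projective dimension in terms of linear maps -/

open CategoryTheory

universe v w

/-- The `R`-module `M` has projective dimension less than `n`. -/
abbrev Module.ProjDimLT (R M : Type w) [CommRing R] [AddCommGroup M] [Module R M] (n : ℕ) : Prop :=
  HasProjectiveDimensionLT (ModuleCat.of R M) n

namespace Module.ProjDimLT

section Basic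

variable {R M M' M'' : Type w} [CommRing R] [AddCommGroup M] [Module R M] [AddCommGroup M']
  [Module R M'] [AddCommGroup M''] [Module R M'']

theorem zero_iff : ProjDimLT R M 0 ↔ Subsingleton M := by
  rw [ProjDimLT, hasProjectiveDimensionLT_zero_iff_isZero]
  exact ModuleCat.isZero_iff_subsingleton

theorem one_iff : ProjDimLT R M 1 ↔ Module.Projective R M := by
  rw [ProjDimLT, ← projective_iff_hasProjectiveDimensionLT_one, ← IsProjective.iff_projective]

theorem mono {m n : ℕ} (h : ProjDimLT R M m) (hmn : m ≤ n) : ProjDimLT R M n :=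
  hasProjectiveDimensionLT_of_ge _ m n hmn

theorem shortExact {f : M →ₗ[R] M'} {g : M' →ₗ[R] M''} (hf : Function.Injective f)
    (hg : Function.Surjective g) (h : Function.Exact f g) :
    (ShortComplex.mk (ModuleCat.ofHom f) (ModuleCat.ofHom g)
      (by ext x; exact h.apply_apply_eq_zero x)).ShortExact where
  exact := (ShortComplex.ShortExact.moduleCat_exact_iff_function_exact _).mpr h
  mono_f := (ModuleCat.mono_iff_injective _).mpr hf
  epi_g := (ModuleCat.epi_iff_surjective _).mpr hg

theorem right {f : M →ₗ[R] M'} {g : M' →ₗ[R] M''} (hf : Function.Injective f)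
    (hg : Function.Surjective g) (h : Function.Exact f g) {n : ℕ} (h₁ : ProjDimLT R M n)
    (h₂ : ProjDimLT R M' (n + 1)) : ProjDimLT R M'' (n + 1) :=
  (shortExact hf hg h).hasProjectiveDimensionLT_X₃ n h₁ h₂

theorem left {f : M →ₗ[R] M'} {g : M' →ₗ[R] M''} (hf : Function.Injective f)
    (hg : Function.Surjective g) (h : Function.Exact f g) {n : ℕ} (h₂ : ProjDimLT R M' n)
    (h₃ : ProjDimLT R M'' (n + 1)) : ProjDimLT R M n :=
  (shortExact hf hg h).hasProjectiveDimensionLT_X₁ n h₂ h₃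

theorem of_retract {i : M →ₗ[R] M'} {r : M' →ₗ[R] M} (h : r.comp i = LinearMap.id) {n : ℕ}
    (hn : ProjDimLT R M' n) : ProjDimLT R M n :=
  Retract.hasProjectiveDimensionLT
    (⟨ModuleCat.ofHom i, ModuleCat.ofHom r, by rw [← ModuleCat.ofHom_comp, h]; rfl⟩ :
      Retract (ModuleCat.of R M) (ModuleCat.of R M')) n

/-- A module over `R` has no larger projective dimension over a ring over which `R` is
projective. -/
theorem restrictScalars {S R : Type w} [CommRing S] [CommRing R] [Algebra S R]
    [Module.Projective S R] {n : ℕ} :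
    ∀ {X : Type w} [AddCommGroup X] [Module R X] [Module S X] [IsScalarTower S R X],
      ProjDimLT R X n → ProjDimLT S X n := by
  have hproj {X : Type w} [AddCommGroup X] [Module R X] [Module S X] [IsScalarTower S R X]
      (h : Module.Projective R X) : Module.Projective S X := by
    obtain ⟨s, hs⟩ := Module.projective_def'.mp h
    have : Module.Projective S (X →₀ R) := by
      classical
      exact Module.Projective.of_equiv (finsuppLequivDFinsupp (ι := X) (M := R) S).symm
    exact Module.Projective.of_split (s.restrictScalars S)
      ((Finsupp.linearCombination R id).restrictScalars S) (LinearMap.ext fun x => LinearMap.congr_fun hs x)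
  induction n with
  | zero => intro X _ _ _ _ h; rw [zero_iff] at h ⊢; exact h
  | succ n ih =>
    intro X _ _ _ _ h
    -- The bound 1 is treated apart: the kernel of a surjection onto a projective module need not
    -- vanish, so the syzygy argument cannot descend to the bound 0.
    rcases n with _ | n
    · rw [zero_add, one_iff] at h ⊢; exact hproj h
    let f : (X →₀ R) →ₗ[R] X := Finsupp.linearCombination R id
    have hf : Function.Surjective f := Finsupp.linearCombination_id_surjective R X
    have h₂ (k : ℕ) : ProjDimLT R (X →₀ R) (k + 1) :=
      (one_iff.mpr inferInstance : ProjDimLT R (X →₀ R) 1).mono (by simp)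
    have hk : ProjDimLT S f.ker (n + 1) :=
      ih (left f.ker.injective_subtype hf (LinearMap.exact_subtype_ker_map f) (h₂ n) h)
    have h₂' : ProjDimLT S (X →₀ R) 1 := one_iff.mpr (hproj inferInstance)
    exact right (f := f.ker.subtype.restrictScalars S) (g := f.restrictScalars S)
      f.ker.injective_subtype hf (LinearMap.exact_subtype_ker_map f) hk (h₂'.mono (by simp))

/-- A surjection onto a projective module splits off its kernel. -/
theorem exists_retraction {f : M →ₗ[R] M'} {g : M' →ₗ[R] M''} (hf : Function.Injective f)
    (hg : Function.Surjective g) (h : Function.Exact f g) (hP : Module.Projective R M'') :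
    ∃ r : M' →ₗ[R] M, r.comp f = LinearMap.id := by
  have := ((Function.Exact.split_tfae h hf hg).out 0 1).mp
    (Module.projective_lifting_property g LinearMap.id hg)
  exact this

end Basic

end Module.ProjDimLT

/-! ### Projective dimension of an external tensor product -/

namespace ExternalTensor

open Module

variable {K : Type v} [Field K]

section

variable {A B M N : Type w} [CommRing A] [CommRing B] [Algebra K A] [Algebra K B]
  [AddCommGroup M] [Module K M] [Module A M] [IsScalarTower K A M]
  [AddCommGroup N] [Module K N] [Module B N] [IsScalarTower K B N]

theorem projectiveDimension_comm :
    projectiveDimension (ModuleCat.of (A ⊗[K] B) (ExternalTensor K M N)) =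
      projectiveDimension (ModuleCat.of (B ⊗[K] A) (ExternalTensor K N M)) := by
  let e : A ⊗[K] B ≃+* B ⊗[K] A := (Algebra.TensorProduct.comm K A B).toRingEquiv
  let := RingHomInvPair.of_ringEquiv e
  let := RingHomInvPair.symm (RingHomClass.toRingHom e) (RingHomClass.toRingHom e.symm)
  exact ModuleCat.projectiveDimension_eq_of_semiLinearEquiv.{w, w} e
    (M := ModuleCat.of (A ⊗[K] B) (ExternalTensor K M N))
    (N := ModuleCat.of (B ⊗[K] A) (ExternalTensor K N M))
    { commEquiv K M N with
      map_smul' := commEquiv_smul }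

theorem projDimLT_comm {n : ℕ} : ProjDimLT (A ⊗[K] B) (ExternalTensor K M N) n ↔
    ProjDimLT (B ⊗[K] A) (ExternalTensor K N M) n := by
  rw [ProjDimLT, ProjDimLT, ← projectiveDimension_lt_iff, ← projectiveDimension_lt_iff,
    projectiveDimension_comm]

instance [Nontrivial M] [Nontrivial N] : Nontrivial (ExternalTensor K M N) :=
  inferInstanceAs (Nontrivial (M ⊗[K] N))

instance [Subsingleton M] : Subsingleton (ExternalTensor K M N) :=
  inferInstanceAs (Subsingleton (M ⊗[K] N))

instance [Subsingleton N] : Subsingleton (ExternalTensor K M N) :=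
  inferInstanceAs (Subsingleton (M ⊗[K] N))

/-- Over `A`, the ring `A ⊗ B` is free because `B` is free over `K`, so the bound survives
restriction to `A`; there `M` is a retract of `M ⊗ N` as soon as `N` is nonzero. -/
theorem projDimLT_left_of_projDimLT [Nontrivial N] {n : ℕ}
    (h : ProjDimLT (A ⊗[K] B) (ExternalTensor K M N) n) : ProjDimLT A M n := by
  let : Module A (ExternalTensor K M N) := inferInstanceAs (Module A (M ⊗[K] N))
  have : IsScalarTower A (A ⊗[K] B) (ExternalTensor K M N) := ⟨fun a r x => by
    induction r using TensorProduct.induction_on with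
    | zero => simp
    | add r s hr hs => rw [smul_add, add_smul, hr, hs, add_smul, smul_add]
    | tmul c b =>
      induction x using induction_on with
      | zero => simp
      | add x y hx hy => rw [smul_add, hx, hy, smul_add, smul_add]
      | tmul m n =>
        change (((a • c) • m) ⊗ₜ[K] (b • n) : M ⊗[K] N) = a • ((c • m) ⊗ₜ[K] (b • n))
        rw [smul_assoc]; rfl⟩
  have h' : ProjDimLT A (ExternalTensor K M N) n := h.restrictScalars
  -- With `ψ y = 1`, contraction by `ψ` is a retraction of `m ↦ m ⊗ y`.
  obtain ⟨y, hy⟩ := exists_ne (0 : N)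
  obtain ⟨ψ, hψ⟩ := Module.Projective.exists_dual_eq_one K hy
  let i : M →ₗ[A] ExternalTensor K M N := (TensorProduct.AlgebraTensorModule.mk K A M N).flip y
  let r : ExternalTensor K M N →ₗ[A] M :=
    (TensorProduct.AlgebraTensorModule.rid K A M).toLinearMap.comp
      (TensorProduct.AlgebraTensorModule.lTensor A M ψ)
  refine h'.of_retract (i := i) (r := r) (LinearMap.ext fun m => ?_)
  change ψ y • m = m
  rw [hψ, one_smul]

theorem projDimLT_right_of_projDimLT [Nontrivial M] {n : ℕ}
    (h : ProjDimLT (A ⊗[K] B) (ExternalTensor K M N) n) : ProjDimLT B N n :=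
  projDimLT_left_of_projDimLT (projDimLT_comm.mp h)

section

variable {M' M'' : Type w}
  [AddCommGroup M'] [Module K M'] [Module A M'] [IsScalarTower K A M']
  [AddCommGroup M''] [Module K M''] [Module A M''] [IsScalarTower K A M'']
  {f : M →ₗ[A] M'} {g : M' →ₗ[A] M''}

theorem projDimLT_of_exact_right (hf : Function.Injective f) (hg : Function.Surjective g)
    (h : Function.Exact f g) {n : ℕ} (h₁ : ProjDimLT (A ⊗[K] B) (ExternalTensor K M N) n)
    (h₂ : ProjDimLT (A ⊗[K] B) (ExternalTensor K M' N) (n + 1)) :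
    ProjDimLT (A ⊗[K] B) (ExternalTensor K M'' N) (n + 1) :=
  ProjDimLT.right (map_left_injective hf) (map_left_surjective hg) (map_left_exact h) h₁ h₂

theorem projDimLT_of_exact_left (hf : Function.Injective f) (hg : Function.Surjective g)
    (h : Function.Exact f g) {n : ℕ} (h₂ : ProjDimLT (A ⊗[K] B) (ExternalTensor K M' N) n)
    (h₃ : ProjDimLT (A ⊗[K] B) (ExternalTensor K M'' N) (n + 1)) :
    ProjDimLT (A ⊗[K] B) (ExternalTensor K M N) n :=
  ProjDimLT.left (map_left_injective hf) (map_left_surjective hg) (map_left_exact h) h₂ h₃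

end

end

/-! ### Upper and lower bounds by passing to syzygies -/

section Induction

variable {A B : Type w} [CommRing A] [CommRing B] [Algebra K A] [Algebra K B]

/-- Induction on syzygies of `M` alone, with `N` fixed. It is used twice: with the factors exchanged
and `m = 0` it yields the case of a projective factor, which is then the hypothesis `h` for the
general bound. -/
theorem projDimLT_add_of_projective [IsNoetherianRing A] {N : Type w} [AddCommGroup N] [Module K N]
    [Module B N] [IsScalarTower K B N] {m : ℕ}
    (h : ∀ {F : Type w} [AddCommGroup F] [Module K F] [Module A F] [IsScalarTower K A F],
      Module.Projective A F → ProjDimLT (A ⊗[K] B) (ExternalTensor K F N) (m + 1)) {n : ℕ} :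
    ∀ {M : Type w} [AddCommGroup M] [Module K M] [Module A M] [IsScalarTower K A M]
      [Module.Finite A M], ProjDimLT A M (n + 1) →
      ProjDimLT (A ⊗[K] B) (ExternalTensor K M N) (n + m + 1) := by
  induction n with
  | zero => intro M _ _ _ _ _ hM; exact (h (ProjDimLT.one_iff.mp hM)).mono (by lia)
  | succ n ih =>
    intro M _ _ _ _ _ hM
    obtain ⟨k, f, hf⟩ := Module.Finite.exists_fin' A M
    have hF : ProjDimLT A (Fin k → A) 1 := ProjDimLT.one_iff.mpr inferInstance
    have hS : ProjDimLT A f.ker (n + 1) := ProjDimLT.left f.ker.injective_subtype hf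
      (LinearMap.exact_subtype_ker_map f) (hF.mono (by simp)) hM
    exact (projDimLT_of_exact_right f.ker.injective_subtype hf
      (LinearMap.exact_subtype_ker_map f) (ih hS)
      ((h (F := Fin k → A) inferInstance).mono (by lia))).mono (by lia)

theorem projDimLT_of_projective [IsNoetherianRing B] {M N : Type w} [AddCommGroup M] [Module K M]
    [Module A M] [IsScalarTower K A M] [AddCommGroup N] [Module K N]
    [Module B N] [IsScalarTower K B N] [Module.Finite B N] (hM : Module.Projective A M) {m : ℕ}
    (hN : ProjDimLT B N (m + 1)) : ProjDimLT (A ⊗[K] B) (ExternalTensor K M N) (m + 1) :=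
  projDimLT_comm.mp (projDimLT_add_of_projective (m := 0)
    (fun hF => ProjDimLT.one_iff.mpr (projective hF hM)) hN)

theorem projDimLT_add [IsNoetherianRing A] [IsNoetherianRing B] {M N : Type w}
    [AddCommGroup M] [Module K M] [Module A M] [IsScalarTower K A M] [Module.Finite A M]
    [AddCommGroup N] [Module K N] [Module B N] [IsScalarTower K B N] [Module.Finite B N] {n m : ℕ}
    (hM : ProjDimLT A M (n + 1)) (hN : ProjDimLT B N (m + 1)) :
    ProjDimLT (A ⊗[K] B) (ExternalTensor K M N) (n + m + 1) :=
  projDimLT_add_of_projective (fun hF => projDimLT_of_projective hF hN) hM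

/-- For positive dimension, a syzygy of `M` has dimension exactly one less, and tensoring with `N`
shifts the bound on the product in the same way, since the middle term has dimension at most `m`.
This reduces the first factor to dimension 1. -/
theorem not_projDimLT_add_of_one [IsNoetherianRing A] [IsNoetherianRing B] {N : Type w}
    [AddCommGroup N] [Module K N] [Module B N] [IsScalarTower K B N] [Module.Finite B N] {m : ℕ}
    (hN : ProjDimLT B N (m + 1))
    (base : ∀ {M : Type w} [AddCommGroup M] [Module K M] [Module A M] [IsScalarTower K A M]
      [Module.Finite A M], ¬ ProjDimLT A M 1 → ProjDimLT A M 2 →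
      ¬ ProjDimLT (A ⊗[K] B) (ExternalTensor K M N) (1 + m)) {n : ℕ} :
    ∀ {M : Type w} [AddCommGroup M] [Module K M] [Module A M] [IsScalarTower K A M]
      [Module.Finite A M], ¬ ProjDimLT A M (n + 1) → ProjDimLT A M (n + 2) →
      ¬ ProjDimLT (A ⊗[K] B) (ExternalTensor K M N) (n + 1 + m) := by
  induction n with
  | zero => intro M _ _ _ _ _ h h'; exact base h h'
  | succ n ih =>
    intro M _ _ _ _ _ h h' hMN
    obtain ⟨k, f, hf⟩ := Module.Finite.exists_fin' A M
    have hF : ProjDimLT A (Fin k → A) 1 := ProjDimLT.one_iff.mpr inferInstance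
    have hS : ProjDimLT A f.ker (n + 2) := ProjDimLT.left f.ker.injective_subtype hf
      (LinearMap.exact_subtype_ker_map f) (hF.mono (by simp)) h'
    have hS' : ¬ ProjDimLT A f.ker (n + 1) := fun hS => h <| ProjDimLT.right
      f.ker.injective_subtype hf (LinearMap.exact_subtype_ker_map f) hS (hF.mono (by simp))
    refine ih hS' hS (projDimLT_of_exact_left f.ker.injective_subtype hf
      (LinearMap.exact_subtype_ker_map f) ?_ (hMN.mono (by lia)))
    exact (projDimLT_of_projective (M := Fin k → A) inferInstance hN).mono (by lia)

/-- If `M ⊗ N` had dimension at most 1, its first syzygy would be projective, so the inclusion of `S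
⊗ T` in `(S ⊗ G) × (F ⊗ T)` would split, against `no_retraction`. Here `S = ker f` and `T = ker g`.
-/
theorem not_projDimLT_two [IsNoetherianRing A] [IsNoetherianRing B] {M N : Type w}
    [AddCommGroup M] [Module K M] [Module A M] [IsScalarTower K A M] [Module.Finite A M]
    [AddCommGroup N] [Module K N] [Module B N] [IsScalarTower K B N] [Module.Finite B N]
    (hM : ¬ ProjDimLT A M 1) (hN : ¬ ProjDimLT B N 1) :
    ¬ ProjDimLT (A ⊗[K] B) (ExternalTensor K M N) 2 := by
  intro h
  obtain ⟨k, f, hf⟩ := Module.Finite.exists_fin' A M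
  obtain ⟨l, g, hg⟩ := Module.Finite.exists_fin' B N
  -- A retraction onto the kernel would split `f`, making `M` a direct summand of a free module.
  have hi : ¬ ∃ r : (Fin k → A) →ₗ[A] f.ker, r.comp f.ker.subtype = LinearMap.id := by
    intro hr
    obtain ⟨s, hs⟩ := ((Function.Exact.split_tfae (LinearMap.exact_subtype_ker_map f)
      f.ker.injective_subtype hf).out 1 0).mp hr
    exact hM (ProjDimLT.one_iff.mpr (Module.Projective.of_split s f hs))
  have hj : ¬ ∃ r : (Fin l → B) →ₗ[B] g.ker, r.comp g.ker.subtype = LinearMap.id := by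
    intro hr
    obtain ⟨s, hs⟩ := ((Function.Exact.split_tfae (LinearMap.exact_subtype_ker_map g)
      g.ker.injective_subtype hg).out 1 0).mp hr
    exact hN (ProjDimLT.one_iff.mpr (Module.Projective.of_split s g hs))
  let i := f.ker.subtype
  let j := g.ker.subtype
  let F := Fin k → A
  let G := Fin l → B
  let p : ExternalTensor K F G →ₗ[A ⊗[K] B] ExternalTensor K M N := map K f g
  have hp : Function.Surjective p :=
    TensorProduct.map_surjective (g := f.restrictScalars K) (g' := g.restrictScalars K) hf hg
  have hZ : Module.Projective (A ⊗[K] B) p.ker := ProjDimLT.one_iff.mp <|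
    ProjDimLT.left p.ker.injective_subtype hp (LinearMap.exact_subtype_ker_map p)
      (ProjDimLT.one_iff.mpr (projective (M := F) (N := G) inferInstance inferInstance)) h
  let φ : ExternalTensor K f.ker g.ker →ₗ[A ⊗[K] B]
      ExternalTensor K f.ker G × ExternalTensor K F g.ker :=
    (map K LinearMap.id j).prod (map K i LinearMap.id)
  -- The sign makes the composite with `φ` vanish: inside `F ⊗ G`, exactness says that `S ⊗ G` and
  -- `F ⊗ T` meet in `S ⊗ T`.
  let γ : ExternalTensor K f.ker G × ExternalTensor K F g.ker →ₗ[A ⊗[K] B] ExternalTensor K F G :=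
    (map K i LinearMap.id).coprod (-(map K LinearMap.id j))
  have hpi (y) : p (map K i LinearMap.id y) = 0 :=
    LinearMap.congr_fun (f := p.comp (map K i (LinearMap.id : G →ₗ[B] G))) (g := 0)
      (linearMap_ext fun x y => by
        change tmul K (f (i x)) (g y) = 0
        rw [show f (i x) = 0 from x.2]
        exact TensorProduct.zero_tmul M (g y)) y
  have hpj (y) : p (map K LinearMap.id j y) = 0 :=
    LinearMap.congr_fun (f := p.comp (map K (LinearMap.id : F →ₗ[A] F) j)) (g := 0)
      (linearMap_ext fun x y => by
        change tmul K (f x) (g (j y)) = 0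
        rw [show g (j y) = 0 from y.2]
        exact TensorProduct.tmul_zero N (f x)) y
  have hγ (y) : γ y ∈ p.ker := by
    simp [γ, hpi, hpj]
  have hγs : Function.Surjective (γ.codRestrict p.ker hγ) := by
    rintro ⟨z, hz⟩
    obtain ⟨x, y, hxy⟩ := exists_of_map_eq_zero (LinearMap.exact_subtype_ker_map f) hf
      (LinearMap.exact_subtype_ker_map g) hg hz
    refine ⟨(x, -y), Subtype.ext (Eq.trans ?_ hxy)⟩
    change map K i LinearMap.id x + -map K LinearMap.id j (-y) = _
    rw [map_neg, neg_neg]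
  have hφ : Function.Injective φ := fun x y hxy =>
    map_right_injective g.ker.injective_subtype (congrArg Prod.fst hxy)
  have hcomm (z : ExternalTensor K f.ker g.ker) : map K i (LinearMap.id : G →ₗ[B] G)
      (map K LinearMap.id j z) = map K LinearMap.id j (map K i LinearMap.id z) :=
    map_left_map_right i j z
  have hφγ : Function.Exact φ (γ.codRestrict p.ker hγ) := by
    intro y
    constructor
    · intro hy
      have hy' : map K i LinearMap.id y.1 = map K LinearMap.id j y.2 :=
        sub_eq_zero.mp ((sub_eq_add_neg _ _).trans (congrArg Subtype.val hy))
      -- It suffices to check vanishing in `F ⊗ N`. There the element is the image of `y.2` under `T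
      -- → G → N` on the second factor, which is zero.
      have hy₁ : map K (LinearMap.id : f.ker →ₗ[A] f.ker) g y.1 = 0 := by
        apply map_left_injective (K := K) (N := N) (B := B) f.ker.injective_subtype
        rw [map_zero]
        have h₁ : map K i LinearMap.id (map K (LinearMap.id : f.ker →ₗ[A] f.ker) g y.1) =
            map K LinearMap.id g (map K i LinearMap.id y.1) :=
          map_left_map_right i g y.1
        refine h₁.trans ?_
        rw [hy']
        exact (map_right_exact (LinearMap.exact_subtype_ker_map g)).apply_apply_eq_zero y.2
      obtain ⟨z, hz⟩ := (map_right_exact (LinearMap.exact_subtype_ker_map g) y.1).mp hy₁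
      refine ⟨z, Prod.ext hz (map_right_injective (M := F) (A := A) g.ker.injective_subtype ?_)⟩
      exact (hcomm z).symm.trans ((congrArg _ hz).trans hy')
    · rintro ⟨z, rfl⟩
      refine Subtype.ext ((sub_eq_add_neg _ _).symm.trans (sub_eq_zero.mpr (hcomm z)))
  obtain ⟨r, hr⟩ := ProjDimLT.exists_retraction hφ hγs hφγ hZ
  refine no_retraction i j hi hj (r.comp (LinearMap.inl _ _ _)) (r.comp (LinearMap.inr _ _ _))
    (Eq.trans ?_ hr)
  ext x
  simp [φ, ← map_add]

theorem not_projDimLT_add [IsNoetherianRing A] [IsNoetherianRing B] {M N : Type w}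
    [AddCommGroup M] [Module K M] [Module A M] [IsScalarTower K A M] [Module.Finite A M]
    [AddCommGroup N] [Module K N] [Module B N] [IsScalarTower K B N] [Module.Finite B N] {n m : ℕ}
    (hM : ¬ ProjDimLT A M n) (hM' : ProjDimLT A M (n + 1))
    (hN : ¬ ProjDimLT B N m) (hN' : ProjDimLT B N (m + 1)) :
    ¬ ProjDimLT (A ⊗[K] B) (ExternalTensor K M N) (n + m) := by
  have : Nontrivial M := by
    by_contra h
    exact hM ((ProjDimLT.zero_iff.mpr (not_nontrivial_iff_subsingleton.mp h)).mono (by simp))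
  have : Nontrivial N := by
    by_contra h
    exact hN ((ProjDimLT.zero_iff.mpr (not_nontrivial_iff_subsingleton.mp h)).mono (by simp))
  -- When one dimension is 0, the claim is that the product has at least the dimension of the other
  -- factor, which holds because both modules are nonzero.
  rcases n with _ | n
  · rw [zero_add]
    exact fun h => hN (projDimLT_right_of_projDimLT h)
  rcases m with _ | m
  · exact fun h => hM (projDimLT_left_of_projDimLT h)
  -- Lower the first factor to dimension 1, then, after exchanging the factors, the second one.
  refine not_projDimLT_add_of_one hN' (fun {P} _ _ _ _ _ hP hP' h => ?_) hM hM'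
  exact not_projDimLT_add_of_one hP' (fun hQ _ h' => not_projDimLT_two hQ hP h') hN hN'
    ((projDimLT_comm.mp h).mono (by lia))

theorem projectiveDimension_eq_add [IsNoetherianRing A] [IsNoetherianRing B] {M N : Type w}
    [AddCommGroup M] [Module K M] [Module A M] [IsScalarTower K A M] [Module.Finite A M]
    [AddCommGroup N] [Module K N] [Module B N] [IsScalarTower K B N] [Module.Finite B N] :
    projectiveDimension (ModuleCat.of (A ⊗[K] B) (ExternalTensor K M N)) =
      projectiveDimension (ModuleCat.of A M) + projectiveDimension (ModuleCat.of B N) := by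
  have hbot {R X : Type w} [CommRing R] [AddCommGroup X] [Module R X] (h : Subsingleton X) :
      projectiveDimension (ModuleCat.of R X) = ⊥ :=
    (projectiveDimension_eq_bot_iff _).mpr (ModuleCat.isZero_iff_subsingleton.mpr h)
  have hne {R X : Type w} [CommRing R] [AddCommGroup X] [Module R X] (h : Nontrivial X) :
      projectiveDimension (ModuleCat.of R X) ≠ ⊥ := fun hX =>
    not_subsingleton X (ModuleCat.isZero_iff_subsingleton.mp
      ((projectiveDimension_eq_bot_iff _).mp hX))
  rcases subsingleton_or_nontrivial M with hM | hM
  · rw [hbot hM, hbot inferInstance, WithBot.bot_add]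
  rcases subsingleton_or_nontrivial N with hN | hN
  · rw [hbot hN, hbot inferInstance, WithBot.add_bot]
  have htop {R X : Type w} [CommRing R] [AddCommGroup X] [Module R X] (h : Nontrivial X) :
      projectiveDimension (ModuleCat.of R X) = ⊤ ∨
      ∃ n : ℕ, projectiveDimension (ModuleCat.of R X) = n := by
    have := hne (R := R) h
    generalize projectiveDimension (ModuleCat.of R X) = d at this
    induction d with
    | bot => exact absurd rfl this
    | coe d =>
      induction d with
      | top => exact Or.inl rfl
      | coe d => exact Or.inr ⟨d, rfl⟩
  -- In the infinite case, any finite bound on the product would descend to the factor of infinite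
  -- dimension.
  have hfin {d : WithBot ℕ∞} (h : ∀ n : ℕ, ¬ d < n) : d = ⊤ := by
    induction d with
    | bot => exact absurd (WithBot.bot_lt_coe _) (h 0)
    | coe d =>
      induction d with
      | top => rfl
      | coe d => exact absurd (by exact_mod_cast d.lt_succ_self) (h (d + 1))
  rcases htop (R := A) hM with hA | ⟨n, hA⟩
  · have h : projectiveDimension (ModuleCat.of (A ⊗[K] B) (ExternalTensor K M N)) = ⊤ := by
      refine hfin fun n hn => ?_
      have h' : ProjDimLT A M n := projDimLT_left_of_projDimLT (projectiveDimension_lt_iff.mp hn)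
      exact not_top_lt (hA ▸ projectiveDimension_lt_iff.mpr h')
    rw [h, hA]
    rcases htop (R := B) hN with hB | ⟨m, hB⟩ <;> rw [hB] <;> rfl
  rcases htop (R := B) hN with hB | ⟨m, hB⟩
  · have h : projectiveDimension (ModuleCat.of (A ⊗[K] B) (ExternalTensor K M N)) = ⊤ := by
      refine hfin fun n hn => ?_
      have h' : ProjDimLT B N n := projDimLT_right_of_projDimLT (projectiveDimension_lt_iff.mp hn)
      exact not_top_lt (hB ▸ projectiveDimension_lt_iff.mpr h')
    rw [h, hA, hB]
    rfl
  rw [hA, hB, ← Nat.cast_add]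
  apply le_antisymm
  · exact (projectiveDimension_le_iff _ _).mpr (projDimLT_add
      ((projectiveDimension_le_iff _ _).mp hA.le) ((projectiveDimension_le_iff _ _).mp hB.le))
  · exact (projectiveDimension_ge_iff _ _).mpr (not_projDimLT_add
      ((projectiveDimension_ge_iff _ _).mp hA.ge) ((projectiveDimension_le_iff _ _).mp hA.le)
      ((projectiveDimension_ge_iff _ _).mp hB.ge) ((projectiveDimension_le_iff _ _).mp hB.le))

end Induction

end ExternalTensor

/-! ### Quotients by ideals in separate variables -/

namespace ExternalTensor

open Module

variable {K : Type v} [Field K] {A B R : Type w} [CommRing A] [CommRing B] [CommRing R]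
  [Algebra K A] [Algebra K B]

/-- The identification of the external tensor product with the tensor product over `K`. -/
def toTensor (K M N : Type*) [Field K] [AddCommGroup M] [AddCommGroup N] [Module K M]
    [Module K N] : ExternalTensor K M N ≃+ M ⊗[K] N :=
  AddEquiv.refl (M ⊗[K] N)

/-- The ring `A ⊗ B` acts on `A/I ⊗ B/J` through the quotient map to that ring; this identifies the
external tensor product with a quotient ring viewed as a module. -/
theorem toTensor_smul (I : Ideal A) (J : Ideal B) (r : A ⊗[K] B)
    (x : ExternalTensor K (A ⧸ I) (B ⧸ J)) :
    toTensor K (A ⧸ I) (B ⧸ J) (r • x) =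
      Algebra.TensorProduct.map (Ideal.Quotient.mkₐ K I) (Ideal.Quotient.mkₐ K J) r *
        toTensor K (A ⧸ I) (B ⧸ J) x := by
  induction r using TensorProduct.induction_on with
  | zero => rw [zero_smul, map_zero, map_zero, zero_mul]
  | add r s hr hs => rw [add_smul, map_add, hr, hs, map_add, add_mul]
  | tmul a b =>
    induction x using induction_on with
    | zero => rw [smul_zero, map_zero, mul_zero]
    | add x y hx hy => rw [smul_add, map_add, hx, hy, map_add, mul_add]
    | tmul m n =>
      obtain ⟨m, rfl⟩ := Ideal.Quotient.mk_surjective m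
      obtain ⟨n, rfl⟩ := Ideal.Quotient.mk_surjective n
      change (Ideal.Quotient.mk I (a * m)) ⊗ₜ[K] (Ideal.Quotient.mk J (b * n)) =
        ((Ideal.Quotient.mk I a) ⊗ₜ[K] (Ideal.Quotient.mk J b)) *
          ((Ideal.Quotient.mk I m) ⊗ₜ[K] (Ideal.Quotient.mk J n))
      rw [Algebra.TensorProduct.tmul_mul_tmul, map_mul, map_mul]

theorem exists_ringEquiv_quotient {S T R : Type*} [CommRing S] [CommRing T] [CommRing R]
    (e : S ≃+* R) (q : S →+* T) (hq : Function.Surjective q) (L : Ideal R)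
    (hL : L = (RingHom.ker q).map (e : S →+* R)) :
    ∃ E : T ≃+* R ⧸ L, ∀ r, E (q r) = Ideal.Quotient.mk L (e r) := by
  refine ⟨(RingHom.quotientKerEquivOfSurjective hq).symm.trans (Ideal.quotientEquiv _ _ e hL),
    fun r => ?_⟩
  have : (RingHom.quotientKerEquivOfSurjective hq).symm (q r) = Ideal.Quotient.mk _ r :=
    (RingEquiv.symm_apply_eq _).mpr rfl
  rw [RingEquiv.trans_apply, this]
  rfl

theorem projectiveDimension_eq_of_addEquiv {S R M : Type w} [CommRing S] [CommRing R]
    [AddCommGroup M] [Module S M] (e : S ≃+* R) (L : Ideal R) (E : M ≃+ R ⧸ L)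
    (hE : ∀ (r : S) (x : M), E (r • x) = Ideal.Quotient.mk L (e r) * E x) :
    projectiveDimension (ModuleCat.of S M) = projectiveDimension (ModuleCat.of R (R ⧸ L)) := by
  let := RingHomInvPair.of_ringEquiv e
  let := RingHomInvPair.symm (RingHomClass.toRingHom e) (RingHomClass.toRingHom e.symm)
  exact ModuleCat.projectiveDimension_eq_of_semiLinearEquiv.{w, w} e
    (M := ModuleCat.of S M) (N := ModuleCat.of R (R ⧸ L))
    { E with
      map_smul' := fun r x => (hE r x).trans (Algebra.smul_def (e r) (E x)).symm }

/-- The projective dimension of a quotient by the sum of two ideals in separate variables. -/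
theorem projectiveDimension_quotient [IsNoetherianRing A] [IsNoetherianRing B]
    (e : A ⊗[K] B ≃+* R) (I : Ideal A) (J : Ideal B) (L : Ideal R)
    (hL : L = (I.map (Algebra.TensorProduct.includeLeft : A →ₐ[K] A ⊗[K] B) ⊔
      J.map (Algebra.TensorProduct.includeRight : B →ₐ[K] A ⊗[K] B)).map (e : A ⊗[K] B →+* R)) :
    projectiveDimension (ModuleCat.of R (R ⧸ L)) =
      projectiveDimension (ModuleCat.of A (A ⧸ I)) +
        projectiveDimension (ModuleCat.of B (B ⧸ J)) := by
  rw [← projectiveDimension_eq_add (K := K)]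
  let q : A ⊗[K] B →ₐ[K] (A ⧸ I) ⊗[K] (B ⧸ J) :=
    Algebra.TensorProduct.map (Ideal.Quotient.mkₐ K I) (Ideal.Quotient.mkₐ K J)
  have hq : Function.Surjective q :=
    TensorProduct.map_surjective (Ideal.Quotient.mkₐ_surjective K I)
      (Ideal.Quotient.mkₐ_surjective K J)
  -- The kernel of a tensor product of surjective algebra maps is generated by the two kernels.
  have hker : RingHom.ker q =
      I.map (Algebra.TensorProduct.includeLeft : A →ₐ[K] A ⊗[K] B) ⊔
        J.map (Algebra.TensorProduct.includeRight : B →ₐ[K] A ⊗[K] B) := by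
    have hI : RingHom.ker (Ideal.Quotient.mkₐ K I) = I := Ideal.mk_ker
    have hJ : RingHom.ker (Ideal.Quotient.mkₐ K J) = J := Ideal.mk_ker
    rw [Algebra.TensorProduct.map_ker _ _ (Ideal.Quotient.mkₐ_surjective K I)
      (Ideal.Quotient.mkₐ_surjective K J), hI, hJ]
  rw [← hker] at hL
  obtain ⟨E, hE⟩ := exists_ringEquiv_quotient e (q : A ⊗[K] B →+* (A ⧸ I) ⊗[K] (B ⧸ J)) hq L hL
  symm
  refine projectiveDimension_eq_of_addEquiv e L
    ((toTensor K (A ⧸ I) (B ⧸ J)).trans E.toAddEquiv) fun r x => ?_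
  change E (toTensor K (A ⧸ I) (B ⧸ J) (r • x)) =
    Ideal.Quotient.mk L (e r) * E (toTensor K (A ⧸ I) (B ⧸ J) x)
  rw [toTensor_smul, map_mul, ← hE]
  rfl

end ExternalTensor

/-! ### Stanley–Reisner ideals of joins -/

namespace StanleyReisner

namespace SimplicialComplex

universe u
variable {α : Type u}

theorem ext_faces {Δ₁ Δ₂ : SimplicialComplex α} (h : Δ₁.faces = Δ₂.faces)
    (h' : Δ₁.verts = Δ₂.verts) : Δ₁ = Δ₂ := by
  obtain ⟨⟨_, _⟩, _, _⟩ := Δ₁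
  obtain ⟨⟨_, _⟩, _, _⟩ := Δ₂
  cases h
  cases h'
  rfl

variable [DecidableEq α]

theorem isFace_join {Δ₁ Δ₂ : SimplicialComplex α} {s : Finset α} :
    (Δ₁.join Δ₂).IsFace s ↔ ∃ F₁ F₂ : Finset α, Δ₁.IsFace F₁ ∧ Δ₂.IsFace F₂ ∧ s = F₁ ∪ F₂ := by
  constructor
  · rintro (rfl | ⟨-, h⟩)
    · exact ⟨∅, ∅, Or.inl rfl, Or.inl rfl, rfl⟩
    · exact h
  · intro h
    rcases s.eq_empty_or_nonempty with rfl | hs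
    · exact Or.inl rfl
    · exact Or.inr ⟨hs, h⟩

theorem isFace_join_left {Δ₁ Δ₂ : SimplicialComplex α} (hd : Disjoint Δ₁.verts Δ₂.verts)
    {s : Finset α} (hs : (s : Set α) ⊆ Δ₁.verts) : (Δ₁.join Δ₂).IsFace s ↔ Δ₁.IsFace s := by
  refine ⟨fun h => ?_, fun h => isFace_join.mpr ⟨s, ∅, h, Or.inl rfl, by simp⟩⟩
  obtain ⟨F₁, F₂, h₁, h₂, rfl⟩ := isFace_join.mp h
  refine h₁.mono (Finset.union_subset subset_rfl fun v hv => ?_)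
  exact absurd (h₂.subset_verts hv) (hd.notMem_of_mem_left (hs (by simp [hv])))

theorem isFace_join_right {Δ₁ Δ₂ : SimplicialComplex α} (hd : Disjoint Δ₁.verts Δ₂.verts)
    {s : Finset α} (hs : (s : Set α) ⊆ Δ₂.verts) : (Δ₁.join Δ₂).IsFace s ↔ Δ₂.IsFace s := by
  refine ⟨fun h => ?_, fun h => isFace_join.mpr ⟨∅, s, Or.inl rfl, h, by simp⟩⟩
  obtain ⟨F₁, F₂, h₁, h₂, rfl⟩ := isFace_join.mp h
  refine h₂.mono (Finset.union_subset (fun v hv => ?_) subset_rfl)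
  exact absurd (hs (by simp [hv])) (hd.notMem_of_mem_left (h₁.subset_verts hv))

variable (K : Type v) [Field K]

/-- A nonface of the join has a trace on one of the two vertex sets that is already a nonface, so
its monomial is divisible by a generator from that side. Conversely, by disjointness, a nonface of
either complex remains a nonface of the join. -/
theorem ideal_join {Δ₁ Δ₂ : SimplicialComplex α} (hd : Disjoint Δ₁.verts Δ₂.verts) :
    (Δ₁.join Δ₂).ideal K =
      (Δ₁.ideal K).map (MvPolynomial.rename (R := K)
        (Set.inclusion (t := (Δ₁.join Δ₂).verts) Set.subset_union_left)) ⊔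
      (Δ₂.ideal K).map (MvPolynomial.rename (R := K)
        (Set.inclusion (t := (Δ₁.join Δ₂).verts) Set.subset_union_right)) := by
  let ι₁ : Δ₁.verts ↪ (Δ₁.join Δ₂).verts :=
    ⟨Set.inclusion Set.subset_union_left, Set.inclusion_injective _⟩
  let ι₂ : Δ₂.verts ↪ (Δ₁.join Δ₂).verts :=
    ⟨Set.inclusion Set.subset_union_right, Set.inclusion_injective _⟩
  change _ = (Δ₁.ideal K).map (MvPolynomial.rename (R := K) ι₁) ⊔
    (Δ₂.ideal K).map (MvPolynomial.rename (R := K) ι₂)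
  have h₁ (F : Finset Δ₁.verts) :
      MvPolynomial.rename ι₁ (∏ w ∈ F, MvPolynomial.X (R := K) w) =
        ∏ w ∈ F.map ι₁, MvPolynomial.X w := by simp
  have h₂ (F : Finset Δ₂.verts) :
      MvPolynomial.rename ι₂ (∏ w ∈ F, MvPolynomial.X (R := K) w) =
        ∏ w ∈ F.map ι₂, MvPolynomial.X w := by simp
  apply le_antisymm
  · rw [ideal, Ideal.span_le]
    rintro _ ⟨F, hF, rfl⟩
    let F₁ := F.preimage ι₁ ι₁.injective.injOn
    let F₂ := F.preimage ι₂ ι₂.injective.injOn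
    -- `F` is the union of its two traces, so if both were faces, `F` would be a face of the join.
    have hF' : ¬ Δ₁.IsFace (F₁.map (Function.Embedding.subtype (· ∈ Δ₁.verts))) ∨
        ¬ Δ₂.IsFace (F₂.map (Function.Embedding.subtype (· ∈ Δ₂.verts))) := by
      by_contra! h
      refine hF (isFace_join.mpr ⟨_, _, h.1, h.2, ?_⟩)
      ext v
      simp only [Finset.mem_map, Finset.mem_union, F₁, F₂, Finset.mem_preimage]
      constructor
      · rintro ⟨⟨v, hv | hv⟩, hvF, rfl⟩
        · exact Or.inl ⟨⟨v, hv⟩, hvF, rfl⟩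
        · exact Or.inr ⟨⟨v, hv⟩, hvF, rfl⟩
      · rintro (⟨v, hv, rfl⟩ | ⟨v, hv, rfl⟩)
        · exact ⟨_, hv, rfl⟩
        · exact ⟨_, hv, rfl⟩
    rcases hF' with hF' | hF'
    · refine Ideal.mem_sup_left (Ideal.mem_of_dvd _ (Finset.prod_dvd_prod_of_subset (F₁.map ι₁) F _
        (Finset.map_subset_iff_subset_preimage.mpr subset_rfl)) ?_)
      rw [← h₁]
      exact Ideal.mem_map_of_mem _ (Ideal.subset_span ⟨F₁, hF', rfl⟩)
    · refine Ideal.mem_sup_right (Ideal.mem_of_dvd _ (Finset.prod_dvd_prod_of_subset (F₂.map ι₂) F _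
        (Finset.map_subset_iff_subset_preimage.mpr subset_rfl)) ?_)
      rw [← h₂]
      exact Ideal.mem_map_of_mem _ (Ideal.subset_span ⟨F₂, hF', rfl⟩)
  · refine sup_le ?_ ?_
    · rw [ideal, Ideal.map_span, Ideal.span_le]
      rintro _ ⟨_, ⟨F, hF, rfl⟩, rfl⟩
      rw [h₁]
      refine Ideal.subset_span ⟨F.map ι₁, fun h => hF ?_, rfl⟩
      rw [Finset.map_map] at h
      exact (isFace_join_left hd (by simp)).mp h
    · rw [ideal, Ideal.map_span, Ideal.span_le]
      rintro _ ⟨_, ⟨F, hF, rfl⟩, rfl⟩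
      rw [h₂]
      refine Ideal.subset_span ⟨F.map ι₂, fun h => hF ?_, rfl⟩
      rw [Finset.map_map] at h
      exact (isFace_join_right hd (by simp)).mp h

theorem pd_join {Δ₁ Δ₂ : SimplicialComplex α} (h₁ : Δ₁.verts.Finite) (h₂ : Δ₂.verts.Finite)
    (hd : Disjoint Δ₁.verts Δ₂.verts) : (Δ₁.join Δ₂).pd K = Δ₁.pd K + Δ₂.pd K := by
  -- Finitely many variables make both polynomial rings Noetherian.
  have := h₁.to_subtype
  have := h₂.to_subtype
  obtain ⟨σ, hσ₁, hσ₂⟩ : ∃ σ : Δ₁.verts ⊕ Δ₂.verts ≃ (Δ₁.join Δ₂).verts,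
      (∀ w, σ (Sum.inl w) = Set.inclusion (t := (Δ₁.join Δ₂).verts) Set.subset_union_left w) ∧
        ∀ w, σ (Sum.inr w) = Set.inclusion (t := (Δ₁.join Δ₂).verts) Set.subset_union_right w := by
    classical
    exact ⟨(Equiv.Set.union hd).symm, fun _ => rfl, fun _ => rfl⟩
  let e : MvPolynomial Δ₁.verts K ⊗[K] MvPolynomial Δ₂.verts K ≃ₐ[K]
      MvPolynomial (Δ₁.join Δ₂).verts K :=
    (MvPolynomial.tensorEquivSum K Δ₁.verts Δ₂.verts K).trans (MvPolynomial.renameEquiv K σ)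
  have he₁ : e.toAlgHom.comp Algebra.TensorProduct.includeLeft = MvPolynomial.rename
      (Set.inclusion (t := (Δ₁.join Δ₂).verts) Set.subset_union_left) := by
    ext1 w
    simp [e, hσ₁]
  have he₂ : e.toAlgHom.comp Algebra.TensorProduct.includeRight = MvPolynomial.rename
      (Set.inclusion (t := (Δ₁.join Δ₂).verts) Set.subset_union_right) := by
    ext1 w
    simp [e, hσ₂]
  refine ExternalTensor.projectiveDimension_quotient (K := K) e.toRingEquiv _ _ _ ?_
  rw [ideal_join K hd, Ideal.map_sup, ← he₁, ← he₂]
  congr 1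
  · exact (Ideal.map_map (I := Δ₁.ideal K) (Algebra.TensorProduct.includeLeft :
      _ →ₐ[K] MvPolynomial Δ₁.verts K ⊗[K] MvPolynomial Δ₂.verts K).toRingHom
      e.toAlgHom.toRingHom).symm
  · exact (Ideal.map_map (I := Δ₂.ideal K) (Algebra.TensorProduct.includeRight :
      _ →ₐ[K] MvPolynomial Δ₁.verts K ⊗[K] MvPolynomial Δ₂.verts K).toRingHom
      e.toAlgHom.toRingHom).symm

end SimplicialComplex

/-! ### Independence complexes of disjoint unions -/

theorem Graph.independenceComplex_sup {α : Type*} [DecidableEq α] {G₁ G₂ : Graph α}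
    (hd : Disjoint G₁.verts G₂.verts) :
    independenceComplex (G₁ ⊔ G₂) = (independenceComplex G₁).join (independenceComplex G₂) := by
  classical
  have hface {G : Graph α} {s : Finset α} : (independenceComplex G).IsFace s ↔
      (s : Set α) ⊆ G.verts ∧ ∀ v ∈ s, ∀ w ∈ s, ¬ G.Adj v w := by
    refine ⟨?_, fun h => s.eq_empty_or_nonempty.imp_right fun hs => ⟨hs, h⟩⟩
    rintro (rfl | h)
    · simp
    · exact h.2
  refine SimplicialComplex.ext_faces (Set.ext fun s => and_congr_right fun _ => ?_) rfl
  simp only [hface, SimpleGraph.Subgraph.verts_sup, SimpleGraph.Subgraph.sup_adj]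
  constructor
  · rintro ⟨hs, h⟩
    refine ⟨s.filter (· ∈ G₁.verts), s.filter (· ∈ G₂.verts), ⟨fun v hv => (Finset.mem_filter.mp hv).2, ?_⟩,
      ⟨fun v hv => (Finset.mem_filter.mp hv).2, ?_⟩, ?_⟩
    · intro v hv w hw hvw
      exact h v (Finset.mem_of_mem_filter v hv) w (Finset.mem_of_mem_filter w hw) (Or.inl hvw)
    · intro v hv w hw hvw
      exact h v (Finset.mem_of_mem_filter v hv) w (Finset.mem_of_mem_filter w hw) (Or.inr hvw)
    · rw [← Finset.filter_or]
      exact (Finset.filter_true_of_mem fun v hv => hs hv).symm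
  · rintro ⟨F₁, F₂, ⟨hF₁, h₁⟩, ⟨hF₂, h₂⟩, rfl⟩
    refine ⟨by rw [Finset.coe_union]; exact Set.union_subset_union hF₁ hF₂, ?_⟩
    -- An edge of the union lies in one of the graphs, so both its ends are vertices of that graph;
    -- disjointness then places them in the corresponding part of the face.
    have mem₁ {v} (hv : v ∈ F₁ ∪ F₂) (hv' : v ∈ G₁.verts) : v ∈ F₁ :=
      (Finset.mem_union.mp hv).resolve_right fun h => hd.notMem_of_mem_left hv' (hF₂ h)
    have mem₂ {v} (hv : v ∈ F₁ ∪ F₂) (hv' : v ∈ G₂.verts) : v ∈ F₂ :=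
      (Finset.mem_union.mp hv).resolve_left fun h => hd.notMem_of_mem_left (hF₁ h) hv'
    rintro v hv w hw (hvw | hvw)
    · exact h₁ v (mem₁ hv hvw.fst_mem) w (mem₁ hw hvw.snd_mem) hvw
    · exact h₂ v (mem₂ hv hvw.fst_mem) w (mem₂ hw hvw.snd_mem) hvw

end StanleyReisner

theorem mainTheorem6 {α : Type*} [DecidableEq α] (K : Type*) [Field K] :
    (∀ Δ₁ Δ₂ : StanleyReisner.SimplicialComplex α,
      Δ₁.verts.Finite → Δ₂.verts.Finite → Disjoint Δ₁.verts Δ₂.verts →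
        (Δ₁.join Δ₂).pd K = Δ₁.pd K + Δ₂.pd K) ∧
    (∀ G₁ G₂ : StanleyReisner.Graph α,
      G₁.verts.Finite → G₂.verts.Finite → Disjoint G₁.verts G₂.verts →
        StanleyReisner.Graph.pd K (G₁ ⊔ G₂) =
          StanleyReisner.Graph.pd K G₁ + StanleyReisner.Graph.pd K G₂) := by
  refine ⟨fun Δ₁ Δ₂ h₁ h₂ hd => StanleyReisner.SimplicialComplex.pd_join K h₁ h₂ hd,
    fun G₁ G₂ h₁ h₂ hd => ?_⟩
  rw [StanleyReisner.Graph.pd, StanleyReisner.Graph.independenceComplex_sup hd]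
  exact StanleyReisner.SimplicialComplex.pd_join K h₁ h₂ hd
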